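/- Let $\mathbf k$ be a commutative ring with identity, let $\lambda,b\in\mathbf k$, and let $T$ be one of the types I ($\lambda=0$, $b=0$), II ($\lambda\neq 0$, $b=0$), III ($\lambda=0$, $b\neq0$). A para-differential Rota-Baxter algebra of type $T$ is an associative, not necessarily unital, $\mathbf k$-algebra $R$ with $\mathbf k$-linear operators $d,P$ such that, for all $x,y\in R$, $$d(xy)=d(x)y+x\,d(y)+\lambda\, d(x)d(y),\qquad P(x)P(y)=P(xP(y))+P(P(x)y)+\lambda P(xy),\qquad d(P(x))=P(d(x))+b\,P(x),$$ where $\lambda,b$ satisfy the condition of type $T$. Let $Z$ be a set and $\Omega=\{D,P\}$. Let $\mathfrak S_\Omega(Z)$ be the free $\Omega$-operated semigroup on $Z$, i.e. the set of bracketed words: nonempty finite words whose letters are elements of $Z$ or of the form $D(u)$, $P(u)$ with $u$ a bracketed word. Let $\mathbf k\mathfrak S_\Omega(Z)$ be the operated algebra with $\mathbf k$-basis $\mathfrak S_\Omega(Z)$ obtained by extending concatenation bilinearly and $D,P$ linearly. Let $S_{\Phi_T}(Z)$ be the set of the elements $$P(u)P(v)-P(uP(v))-P(P(u)v)-\lambda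 P(uv),\quad D(uv)-D(u)v-uD(v)-\lambda D(u)D(v),\quad D(P(u))-P(D(u))-bP(u)$$ with $u,v\in\mathbf k\mathfrak S_\Omega(Z)$, let $\mathrm{Id}(S_{\Phi_T}(Z))$ be the smallest two-sided ideal ($\mathbf k$-submodule) of $\mathbf k\mathfrak S_\Omega(Z)$ that is stable under $D$ and $P$ and contains $S_{\Phi_T}(Z)$, and let $\eta:\mathbf k\mathfrak S_\Omega(Z)\to\mathbf k\mathfrak S_\Omega(Z)/\mathrm{Id}(S_{\Phi_T}(Z))$ be the quotient map. A $\star$-bracketed word is a bracketed word $q$ on $Z\sqcup\{\star\}$ in which $\star$ occurs exactly once; $q|_u$ denotes the result of replacing $\star$ by $u$. Let $$\mathrm{Irr}(S_{\Phi_T}(Z))=\mathfrak S_\Omega(Z)\setminus\{\,q|_{P(u)P(v)},\ q|_{D(uv)},\ q|_{D(P(u))}\mid u,v\in\mathfrak S_\Omega(Z),\ q\text{ a }\star\text{-bracketed word}\,\}.$$ Let $\Delta(Z)=\{D^n(z)\mid z\in Z,\ n\ge0\}$, let $\mathfrak X_0=S(\Delta(Z))$ be the subsemigroup of $\mathfrak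 S_\Omega(Z)$ generated by $\Delta(Z)$, and for $n\ge1$ let $\mathfrak X_n=\Lambda(\mathfrak X_0,\mathfrak X_{n-1})$, where $$\Lambda(Y,W)=\bigcup_{r\ge1}(YP(W))^r\ \cup\ \bigcup_{r\ge0}(YP(W))^rY\ \cup\ \bigcup_{r\ge1}(P(W)Y)^r\ \cup\ \bigcup_{r\ge0}(P(W)Y)^rP(W);$$ let $\mathfrak X_\infty=\bigcup_{n\ge0}\mathfrak X_n$ be the set of differential Rota-Baxter bracketed words. Then for each type $T$: 1. $\mathbf k\mathfrak S_\Omega(Z)/\mathrm{Id}(S_{\Phi_T}(Z))$, with the induced product and operators, is a para-differential Rota-Baxter algebra of type $T$, and it is the free one on $Z$: for every para-differential Rota-Baxter algebra $(R,d,P)$ of type $T$ (with the same $\lambda,b$) and every map $f:Z\to R$ there is a unique algebra homomorphism $F$ from the quotient to $R$ that commutes with the operators and satisfies $F(\eta(z))=f(z)$ for all $z\in Z$. 2. The family $(\eta(t))_{t\in\mathrm{Irr}(S_{\Phi_T}(Z))}$ is a $\mathbf k$-linear basis of $\mathbf k\mathfrak S_\Omega(Z)/\mathrm{Id}(S_{\Phi_T}(Z))$.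 3. $\mathrm{Irr}(S_{\Phi_T}(Z))=\mathfrak X_\infty$. -/

import Mathlib

open scoped Pointwise

namespace ParaDRB

universe u v w

/-! ### The free operated semigroup of bracketed words -/

/-- Bracketed words on the generating set `Z` with bracket symbols `Ω`, i.e. nonempty finite words
whose letters are elements `z` of `Z` or brackets `⌊u⌋_ω` around bracketed words `u`.  A word is
either a single letter (`var`, `op`) or a letter followed by a word (`varMul`, `opMul`), so that
every bracketed word has exactly one presentation. -/
inductive BWord (Ω : Type u) (Z : Type v) : Type (max u v)
  /-- the one-letter word `z` -/
  | var (z : Z) : BWord Ω Z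
  /-- the one-letter word `⌊u⌋_ω` -/
  | op (o : Ω) (u : BWord Ω Z) : BWord Ω Z
  /-- the word `z t` -/
  | varMul (z : Z) (t : BWord Ω Z) : BWord Ω Z
  /-- the word `⌊u⌋_ω t` -/
  | opMul (o : Ω) (u : BWord Ω Z) (t : BWord Ω Z) : BWord Ω Z

namespace BWord

variable {Ω : Type u} {Z : Type v} {Y : Type w}

/-- Concatenation of bracketed words. -/
def mul : BWord Ω Z → BWord Ω Z → BWord Ω Z
  | var z, t => varMul z t
  | op o u, t => opMul o u t
  | varMul z s, t => varMul z (mul s t)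
  | opMul o u s, t => opMul o u (mul s t)

instance : Mul (BWord Ω Z) := ⟨mul⟩

theorem mul_def (s t : BWord Ω Z) : s * t = mul s t := rfl

protected theorem mul_assoc (r s t : BWord Ω Z) : r * s * t = r * (s * t) := by
  simp only [mul_def]
  induction r with
  | var z => rfl
  | op o u _ => rfl
  | varMul z r ih => simp only [mul, ih]
  | opMul o u r _ ih => simp only [mul, ih]

instance : Semigroup (BWord Ω Z) where
  mul_assoc := BWord.mul_assoc

/-- Simultaneous substitution of bracketed words for the generators. -/
def subst (f : Z → BWord Ω Y) : BWord Ω Z → BWord Ω Y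
  | var z => f z
  | op o u => op o (subst f u)
  | varMul z t => f z * subst f t
  | opMul o u t => op o (subst f u) * subst f t

/-- In a word over `Z ∪ {⋆}`, where `none : Option Z` plays the role of `⋆`, the number of
occurrences of `⋆` (at any bracket depth). -/
def starCount : BWord Ω (Option Z) → ℕ
  | var none => 1
  | var (some _) => 0
  | op _ u => starCount u
  | varMul none t => 1 + starCount t
  | varMul (some _) t => starCount t
  | opMul _ u t => starCount u + starCount t

/-- `⋆`-bracketed words: those in which `⋆` occurs exactly once. -/
def IsStarWord (q : BWord Ω (Option Z)) : Prop := starCount q = 1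

/-- `q|_u`, the word obtained from `q` by replacing `⋆` by `u`. -/
def plug (q : BWord Ω (Option Z)) (u : BWord Ω Z) : BWord Ω Z :=
  subst (fun z => z.elim u var) q

end BWord

/-! ### The free operated (nonunitary) algebra -/

/-- `𝐤 𝔖_Ω(Z)`: finite linear combinations of bracketed words, with the bilinear extension of
concatenation as product. -/
abbrev Poly (k : Type u) [CommRing k] (Ω : Type v) (Z : Type w) : Type (max u v w) :=
  MonoidAlgebra k (BWord Ω Z)

section Poly

variable {k : Type u} [CommRing k] {Ω : Type v} {Z : Type w}

/-- A bracketed word as an element of the free operated algebra. -/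
noncomputable def word (k : Type u) [CommRing k] (t : BWord Ω Z) : Poly k Ω Z :=
  MonoidAlgebra.single t 1

/-- The linear extension of `u ↦ ⌊u⌋_o`. -/
noncomputable def opLin (k : Type u) [CommRing k] (Z : Type w) (o : Ω) :
    Poly k Ω Z →ₗ[k] Poly k Ω Z :=
  MonoidAlgebra.mapDomainLinearMap k k (BWord.op o)

/-- Operated ideals: `𝐤`-submodules that absorb multiplication from both sides and are stable under
all the operators. -/
structure IsOperatedIdeal (I : Submodule k (Poly k Ω Z)) : Prop where
  mul_left : ∀ a x, x ∈ I → a * x ∈ I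
  mul_right : ∀ a x, x ∈ I → x * a ∈ I
  op_mem : ∀ (o : Ω) x, x ∈ I → opLin k Z o x ∈ I

/-- `Id(S)`, the smallest operated ideal containing `S`. -/
noncomputable def opIdeal (S : Set (Poly k Ω Z)) : Submodule k (Poly k Ω Z) :=
  sInf {I | IsOperatedIdeal I ∧ S ⊆ (I : Set (Poly k Ω Z))}

theorem isOperatedIdeal_opIdeal (S : Set (Poly k Ω Z)) : IsOperatedIdeal (opIdeal S) where
  mul_left a x hx := by
    rw [opIdeal, Submodule.mem_sInf] at *
    exact fun I hI => hI.1.mul_left a x (hx I hI)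
  mul_right a x hx := by
    rw [opIdeal, Submodule.mem_sInf] at *
    exact fun I hI => hI.1.mul_right a x (hx I hI)
  op_mem o x hx := by
    rw [opIdeal, Submodule.mem_sInf] at *
    exact fun I hI => hI.1.op_mem o x (hx I hI)

/-! ### The quotient of the free operated algebra by `Id(S)` -/

/-- The quotient module `𝐤𝔖_Ω(Z) / Id(S)`. -/
abbrev QuotAlg (S : Set (Poly k Ω Z)) : Type (max u v w) := Poly k Ω Z ⧸ opIdeal S

/-- The canonical quotient map `η`. -/
noncomputable def eta (S : Set (Poly k Ω Z)) : Poly k Ω Z →ₗ[k] QuotAlg S := (opIdeal S).mkQ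

theorem eta_surjective (S : Set (Poly k Ω Z)) : Function.Surjective (eta S) :=
  (opIdeal S).mkQ_surjective

theorem eta_eq_iff (S : Set (Poly k Ω Z)) (x y : Poly k Ω Z) :
    eta S x = eta S y ↔ x - y ∈ opIdeal S :=
  Submodule.Quotient.eq (opIdeal S)

/-- The product induced on the quotient. -/
noncomputable def quotMul (S : Set (Poly k Ω Z)) : QuotAlg S → QuotAlg S → QuotAlg S :=
  Quotient.map₂ (fun x y => x * y) (by
    intro x x' hx y y' hy
    have hx' : x - x' ∈ opIdeal S := (Submodule.quotientRel_def _).1 hx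
    have hy' : y - y' ∈ opIdeal S := (Submodule.quotientRel_def _).1 hy
    refine (Submodule.quotientRel_def _).2 ?_
    have h : x * y - x' * y' = (x - x') * y + x' * (y - y') := by
      rw [sub_mul, mul_sub]; abel
    rw [h]
    exact (opIdeal S).add_mem ((isOperatedIdeal_opIdeal S).mul_right _ _ hx')
      ((isOperatedIdeal_opIdeal S).mul_left _ _ hy'))

noncomputable instance (S : Set (Poly k Ω Z)) : Mul (QuotAlg S) := ⟨quotMul S⟩

theorem eta_mul (S : Set (Poly k Ω Z)) (x y : Poly k Ω Z) :
    eta S (x * y) = eta S x * eta S y := rfl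

noncomputable instance (S : Set (Poly k Ω Z)) : NonUnitalRing (QuotAlg S) :=
  { (inferInstance : AddCommGroup (QuotAlg S)), (inferInstance : Mul (QuotAlg S)) with
    left_distrib := by
      intro a b c
      obtain ⟨a, rfl⟩ := eta_surjective S a
      obtain ⟨b, rfl⟩ := eta_surjective S b
      obtain ⟨c, rfl⟩ := eta_surjective S c
      change eta S (a * (b + c)) = eta S (a * b + a * c)
      rw [mul_add]
    right_distrib := by
      intro a b c
      obtain ⟨a, rfl⟩ := eta_surjective S a
      obtain ⟨b, rfl⟩ := eta_surjective S b
      obtain ⟨c, rfl⟩ := eta_surjective S c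
      change eta S ((a + b) * c) = eta S (a * c + b * c)
      rw [add_mul]
    zero_mul := by
      intro a
      obtain ⟨a, rfl⟩ := eta_surjective S a
      change eta S (0 * a) = eta S 0
      rw [zero_mul]
    mul_zero := by
      intro a
      obtain ⟨a, rfl⟩ := eta_surjective S a
      change eta S (a * 0) = eta S 0
      rw [mul_zero]
    mul_assoc := by
      intro a b c
      obtain ⟨a, rfl⟩ := eta_surjective S a
      obtain ⟨b, rfl⟩ := eta_surjective S b
      obtain ⟨c, rfl⟩ := eta_surjective S c
      change eta S (a * b * c) = eta S (a * (b * c))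
      rw [mul_assoc] }

instance (S : Set (Poly k Ω Z)) : IsScalarTower k (QuotAlg S) (QuotAlg S) where
  smul_assoc r a b := by
    obtain ⟨a, rfl⟩ := eta_surjective S a
    obtain ⟨b, rfl⟩ := eta_surjective S b
    change eta S ((r • a) * b) = eta S (r • (a * b))
    rw [smul_mul_assoc]

instance (S : Set (Poly k Ω Z)) : SMulCommClass k (QuotAlg S) (QuotAlg S) where
  smul_comm r a b := by
    obtain ⟨a, rfl⟩ := eta_surjective S a
    obtain ⟨b, rfl⟩ := eta_surjective S b
    change eta S (r • (a * b)) = eta S (a * (r • b))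
    rw [mul_smul_comm]

/-- The operator induced on the quotient by `⌊ ⌋_o`. -/
noncomputable def quotOp (S : Set (Poly k Ω Z)) (o : Ω) : QuotAlg S →ₗ[k] QuotAlg S :=
  (opIdeal S).mapQ (opIdeal S) (opLin k Z o) (fun x hx => (isOperatedIdeal_opIdeal S).op_mem o x hx)

theorem quotOp_eta (S : Set (Poly k Ω Z)) (o : Ω) (x : Poly k Ω Z) :
    quotOp S o (eta S x) = eta S (opLin k Z o x) := rfl

end Poly

/-! ### Para-differential Rota-Baxter algebras -/

/-- The three types. -/
inductive PType
  | I
  | II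
  | III

/-- The condition that each type puts on the weight `lam` and the parameter `b`. -/
def PType.Admissible {k : Type u} [CommRing k] (T : PType) (lam b : k) : Prop :=
  match T with
  | I => lam = 0 ∧ b = 0
  | II => lam ≠ 0 ∧ b = 0
  | III => lam = 0 ∧ b ≠ 0

/-- `(R, d, P)` is a para-differential Rota-Baxter algebra of type `T`, for the weight `lam` and the
parameter `b` (`R` a not necessarily unital associative algebra). -/
structure IsParaDRB {k : Type u} [CommRing k] (T : PType) (lam b : k)
    {R : Type w} [NonUnitalRing R] [Module k R] (d P : R →ₗ[k] R) : Prop where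
  admissible : T.Admissible lam b
  /-- `d` is a differential operator of weight `lam` -/
  diff : ∀ x y, d (x * y) = d x * y + x * d y + lam • (d x * d y)
  /-- `P` is a Rota-Baxter operator of weight `lam` -/
  rotaBaxter : ∀ x y, P x * P y = P (P x * y) + P (x * P y) + lam • P (x * y)
  /-- `dP = Pd + bP` -/
  mixed : ∀ x, d (P x) = P (d x) + b • P x

/-- The operator symbols `Ω = {D, P}`. -/
inductive Sym
  | D
  | P

section Relations

variable {k : Type u} [CommRing k] {Z : Type v}

/-- `P(u)P(v) - P(uP(v)) - P(P(u)v) - lam P(uv)` -/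
noncomputable def phi1 (lam : k) (x y : Poly k Sym Z) : Poly k Sym Z :=
  opLin k Z Sym.P x * opLin k Z Sym.P y - opLin k Z Sym.P (x * opLin k Z Sym.P y)
    - opLin k Z Sym.P (opLin k Z Sym.P x * y) - lam • opLin k Z Sym.P (x * y)

/-- `D(uv) - D(u)v - uD(v) - lam D(u)D(v)` -/
noncomputable def phi2 (lam : k) (x y : Poly k Sym Z) : Poly k Sym Z :=
  opLin k Z Sym.D (x * y) - opLin k Z Sym.D x * y - x * opLin k Z Sym.D y
    - lam • (opLin k Z Sym.D x * opLin k Z Sym.D y)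

/-- `D(P(u)) - P(D(u)) - b P(u)` -/
noncomputable def phi3 (b : k) (x : Poly k Sym Z) : Poly k Sym Z :=
  opLin k Z Sym.D (opLin k Z Sym.P x) - opLin k Z Sym.P (opLin k Z Sym.D x)
    - b • opLin k Z Sym.P x

/-- `S_{Φ_T}(Z)`: all instances of the defining identities of the type that `lam` and `b` belong to
(type I: `lam = b = 0`; type II: `lam ≠ 0`, `b = 0`; type III: `lam = 0`, `b ≠ 0`). -/
def relations (lam b : k) (Z : Type v) : Set (Poly k Sym Z) :=
  {f | (∃ x y, f = phi1 lam x y) ∨ (∃ x y, f = phi2 lam x y) ∨ ∃ x, f = phi3 b x}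

end Relations

/-! ### Irreducible words and differential Rota-Baxter bracketed words -/

section Words

variable {Z : Type v}

/-- The words that contain no subword `P(u)P(v)`, `D(uv)` or `D(P(u))`. -/
def irr (Z : Type v) : Set (BWord Sym Z) :=
  Set.univ \ {t | ∃ q : BWord Sym (Option Z), q.IsStarWord ∧
    ((∃ u v, t = q.plug (BWord.op Sym.P u * BWord.op Sym.P v)) ∨
     (∃ u v, t = q.plug (BWord.op Sym.D (u * v))) ∨
     (∃ u, t = q.plug (BWord.op Sym.D (BWord.op Sym.P u))))}

/-- `A^r B`, for sets of bracketed words; in particular `A^r A = A^(r+1)`. -/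
def powMul (A : Set (BWord Sym Z)) (r : ℕ) (B : Set (BWord Sym Z)) : Set (BWord Sym Z) :=
  (fun C => A * C)^[r] B

/-- The alternating product `Λ(Y, W)`. -/
def altProd (Y W : Set (BWord Sym Z)) : Set (BWord Sym Z) :=
  let PW := BWord.op Sym.P '' W
  (⋃ r : ℕ, powMul (Y * PW) r (Y * PW)) ∪ (⋃ r : ℕ, powMul (Y * PW) r Y) ∪
    (⋃ r : ℕ, powMul (PW * Y) r (PW * Y)) ∪ (⋃ r : ℕ, powMul (PW * Y) r PW)

/-- `Δ(Z) = {D^n(z)}`. -/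
def delta (Z : Type v) : Set (BWord Sym Z) :=
  {t | ∃ (z : Z) (n : ℕ), t = (BWord.op Sym.D)^[n] (BWord.var z)}

/-- `𝔛_0 = S(Δ(Z))` and `𝔛_{n+1} = Λ(𝔛_0, 𝔛_n)`. -/
def frakX (Z : Type v) : ℕ → Set (BWord Sym Z)
  | 0 => (Subsemigroup.closure (delta Z) : Set (BWord Sym Z))
  | n + 1 => altProd (Subsemigroup.closure (delta Z) : Set (BWord Sym Z)) (frakX Z n)

/-- `𝔛_∞`, the set of differential Rota-Baxter bracketed words. -/
def frakXInf (Z : Type v) : Set (BWord Sym Z) := ⋃ n, frakX Z n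

end Words

end ParaDRB

/-! Read the three identities as rewriting rules that eliminate `P(u)P(v)`, `D(uv)` and `D(P(u))`.
The irreducible words are those to which no rule applies, so they ought to span the quotient; the
substance is their linear independence. This is obtained from a concrete model rather than from an
analysis of critical pairs.

The model is the module of all bracketed words with a second product `diaL`: concatenation, except
that a `P(u)P(v)` created at the junction is expanded recursively by the Rota-Baxter identity. Its
operators are the bracket `P` and the map `derL`, which obeys the Leibniz rule for concatenation,
puts a bracket `D` around a letter not of the form `P(u)`, and sends `P(u)` to `P(derL u) + b P(u)`.
Associativity (`dia_assoc`) and the Leibniz rule for the new product (`derL_dia`) follow by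
induction on size. The latter uses the parameters only through `lam * b = 0`, which holds in all
three types.

By the universal property there is a homomorphism from the quotient to the model that fixes the
generators. Nothing has to be expanded when an irreducible word is evaluated in the model, so the
word evaluates to itself (`evalWord_diaAlg`). Distinct words are independent in the model, hence the
irreducible ones are independent in the quotient.

For spanning, the span of the irreducible words is shown to be closed under the product
(`eta_word_mul_mem`) and under `D` (`quotOp_D_mem`); closure under `P` is immediate.

The predicate `IsNormal` describes irreducibility letter by letter. It mediates between the
definition by forbidden subwords (`mem_irr_iff_isNormal`) and the alternating products
(`irr_eq_frakXInf`). -/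

namespace ParaDRB

universe u v w

open BWord ParaDRB.Sym

/-! ### Linear extension from words -/

section Linear

variable {k : Type u} [CommRing k] {Ω : Type v} {Z : Type w} {M : Type*} [AddCommGroup M]
  [Module k M]

theorem poly_induction {p : Poly k Ω Z → Prop} (x : Poly k Ω Z) (zero : p 0)
    (add : ∀ x y, p x → p y → p (x + y)) (smul : ∀ (c : k) x, p x → p (c • x))
    (word : ∀ t, p (word k t)) : p x := by
  refine MonoidAlgebra.induction_linear x zero add fun t r => ?_
  have h := smul r _ (word t)
  rwa [ParaDRB.word, MonoidAlgebra.smul_single, smul_eq_mul, mul_one] at h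

/-- The linear extension of a map defined on bracketed words. -/
noncomputable def wordLift (k : Type u) [CommRing k] [Module k M] (f : BWord Ω Z → M) :
    Poly k Ω Z →ₗ[k] M :=
  Finsupp.linearCombination k f ∘ₗ (MonoidAlgebra.coeffLinearEquiv k).toLinearMap

@[simp]
theorem wordLift_word (f : BWord Ω Z → M) (t : BWord Ω Z) : wordLift k f (word k t) = f t := by
  simp [wordLift, word]

theorem word_mul (s t : BWord Ω Z) : word k (s * t) = word k s * word k t := by
  simp [word, MonoidAlgebra.single_mul_single]

@[simp]
theorem opLin_word (o : Ω) (t : BWord Ω Z) : opLin k Z o (word k t) = word k (op o t) := by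
  simp [word, opLin]

theorem word_varMul (z : Z) (t : BWord Ω Z) :
    word k (varMul z t) = word k (var z) * word k t := word_mul (var z) t

theorem word_opMul (o : Ω) (s t : BWord Ω Z) :
    word k (opMul o s t) = word k (op o s) * word k t := word_mul (op o s) t

end Linear

/-! ### The free operated algebra as a para-differential Rota-Baxter algebra -/

section Dia

variable {k : Type u} [CommRing k] {Z : Type v}

theorem sizeOf_pos {Ω : Type u} {Z : Type v} [SizeOf Ω] [SizeOf Z] (t : BWord Ω Z) :
    0 < sizeOf t := by
  cases t <;> simp

/-- The product of two words in which a factor `P(u)P(v)` that arises at the junction is expanded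
by the Rota-Baxter identity. -/
noncomputable def dia (lam : k) : BWord Sym Z → BWord Sym Z → Poly k Sym Z
  | varMul z s, t => word k (var z) * dia lam s t
  | opMul o u s, t => word k (op o u) * dia lam s t
  | var z, t => word k (var z) * word k t
  | op D u, t => word k (op D u) * word k t
  | op P u, op P w =>
      opLin k Z P (dia lam u (op P w)) + opLin k Z P (dia lam (op P u) w)
        + lam • opLin k Z P (dia lam u w)
  | op P u, opMul P w t => dia lam (op P u) (op P w) * word k t
  | op P u, var z => word k (op P u) * word k (var z)
  | op P u, varMul z t => word k (op P u) * word k (varMul z t)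
  | op P u, op D w => word k (op P u) * word k (op D w)
  | op P u, opMul D w t => word k (op P u) * word k (opMul D w t)
termination_by s t => sizeOf s + sizeOf t
decreasing_by all_goals simp_wf; first | done | omega | exact sizeOf_pos _

/-- The bilinear extension of `dia`. -/
noncomputable def diaL (lam : k) : Poly k Sym Z →ₗ[k] Poly k Sym Z →ₗ[k] Poly k Sym Z :=
  wordLift k fun s => wordLift k (dia lam s)

variable (lam b : k)

theorem diaL_word (s t : BWord Sym Z) : diaL lam (word k s) (word k t) = dia lam s t := by
  simp [diaL]

/-- Only the last letter on the left and the first letter on the right interact, so all other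
letters pass through. A `P(u)P(v)` away from the junction stays untouched, which is why no normality
is assumed. With `dia_mul_right` this reduces later claims to single letters. -/
theorem dia_mul_left (r s t : BWord Sym Z) : dia lam (r * s) t = word k r * dia lam s t := by
  induction r with
  | var z => exact dia.eq_1 ..
  | op o u _ => exact dia.eq_2 ..
  | varMul z r ih =>
    rw [word_varMul, mul_assoc, ← ih]
    exact dia.eq_1 ..
  | opMul o u r _ ih =>
    rw [word_opMul, mul_assoc, ← ih]
    exact dia.eq_2 ..

theorem diaL_mul_left (x y z : Poly k Sym Z) :
    diaL lam (x * y) z = x * diaL lam y z := by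
  induction x using poly_induction with
  | zero => simp
  | add x x' h h' => simp [add_mul, h, h']
  | smul c x h => simp [h, smul_mul_assoc]
  | word r =>
    induction y using poly_induction with
    | zero => simp
    | add x x' h h' => simp [mul_add, h, h']
    | smul c x h => simp [h, mul_smul_comm]
    | word s =>
      induction z using poly_induction with
      | zero => simp
      | add x x' h h' => simp [mul_add, h, h']
      | smul c x h => simp [h, mul_smul_comm]
      | word t => rw [← word_mul, diaL_word, diaL_word, dia_mul_left]

theorem dia_mul_right (r s t : BWord Sym Z) : dia lam r (s * t) = dia lam r s * word k t := by
  induction r with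
  | var z => rw [dia, dia, word_mul, mul_assoc]
  | op o u _ =>
    cases o with
    | D => rw [dia, dia, word_mul, mul_assoc]
    | P =>
      cases s with
      | var z =>
        change dia lam _ (varMul z t) = _
        rw [dia, dia, word_varMul, mul_assoc]
      | op o w =>
        change dia lam _ (opMul o w t) = _
        cases o with
        | D => rw [dia, dia, word_opMul, mul_assoc]
        | P => rw [dia.eq_def]
      | varMul z s =>
        change dia lam _ (varMul z (s * t)) = _
        rw [dia, dia, word_varMul, word_varMul, word_mul, mul_assoc, mul_assoc]
      | opMul o w s =>
        change dia lam _ (opMul o w (s * t)) = _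
        cases o with
        | D => rw [dia, dia, word_opMul, word_opMul, word_mul, mul_assoc, mul_assoc]
        | P => rw [dia, word_mul, dia.eq_def lam _ (opMul P w s), mul_assoc]
  | varMul z r ih => rw [dia, dia, ih, mul_assoc]
  | opMul o u r _ ih => rw [dia, dia, ih, mul_assoc]

theorem diaL_mul_right (x y z : Poly k Sym Z) :
    diaL lam x (y * z) = diaL lam x y * z := by
  induction x using poly_induction with
  | zero => simp
  | add x x' h h' => simp [add_mul, h, h']
  | smul c x h => simp [h, smul_mul_assoc]
  | word r =>
    induction y using poly_induction with
    | zero => simp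
    | add x x' h h' => simp [add_mul, h, h']
    | smul c x h => simp [h, smul_mul_assoc]
    | word s =>
      induction z using poly_induction with
      | zero => simp
      | add x x' h h' => simp [mul_add, h, h']
      | smul c x h => simp [h, mul_smul_comm]
      | word t => rw [← word_mul, diaL_word, diaL_word, dia_mul_right]

theorem diaL_opLin (x y : Poly k Sym Z) :
    diaL lam (opLin k Z P x) (opLin k Z P y) =
      opLin k Z P (diaL lam x (opLin k Z P y)) + opLin k Z P (diaL lam (opLin k Z P x) y)
        + lam • opLin k Z P (diaL lam x y) := by
  induction x using poly_induction with
  | zero => simp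
  | add x x' h h' => simp [h, h']; abel
  | smul c x h => simp [h, smul_comm c lam]
  | word r =>
    induction y using poly_induction with
    | zero => simp
    | add x x' h h' =>
      rw [opLin_word] at h h' ⊢
      simp only [map_add, h, h', smul_add]; abel
    | smul c x h =>
      rw [opLin_word] at h ⊢
      simp only [map_smul, h, smul_add, smul_comm c lam]
    | word s => simp only [opLin_word, diaL_word]; rw [dia]

/-- The letters that are not of the form `P(u)`. -/
def IsDiffLetter : BWord Sym Z → Prop
  | var _ => True
  | op D _ => True
  | _ => False

theorem IsDiffLetter.diaL_left {a : BWord Sym Z} (ha : IsDiffLetter a) (x : Poly k Sym Z) :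
    diaL lam (word k a) x = word k a * x := by
  induction x using poly_induction with
  | zero => simp
  | add x x' h h' => simp [mul_add, h, h']
  | smul c x h => simp [h, mul_smul_comm]
  | word s =>
    rw [diaL_word]
    match a, ha with
    | var _, _ => rw [dia]
    | op D _, _ => rw [dia]

theorem IsDiffLetter.dia_right {a : BWord Sym Z} (ha : IsDiffLetter a) (s : BWord Sym Z) :
    dia lam s a = word k s * word k a := by
  induction s with
  | var z => rw [dia]
  | op o u _ =>
    match o, a, ha with
    | D, _, _ => rw [dia]
    | P, var _, _ => rw [dia]
    | P, op D _, _ => rw [dia]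
  | varMul z r ih => rw [dia, ih, word_varMul, mul_assoc]
  | opMul o u r _ ih => rw [dia, ih, word_opMul, mul_assoc]

theorem IsDiffLetter.diaL_right {a : BWord Sym Z} (ha : IsDiffLetter a) (x : Poly k Sym Z) :
    diaL lam x (word k a) = x * word k a := by
  induction x using poly_induction with
  | zero => simp
  | add x x' h h' => simp [add_mul, h, h']
  | smul c x h => simp [h, smul_mul_assoc]
  | word s => rw [diaL_word, ha.dia_right]

/-- A word is a differential letter, a letter `P(u)`, or a product. -/
theorem word_cases (t : BWord Sym Z) :
    IsDiffLetter t ∨ (∃ u, t = op P u) ∨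
      ∃ a s, t = a * s ∧ sizeOf a < sizeOf t ∧ sizeOf s < sizeOf t := by
  match t with
  | var z => exact .inl trivial
  | op D u => exact .inl trivial
  | op P u => exact .inr (.inl ⟨u, rfl⟩)
  | varMul z s => exact .inr (.inr ⟨var z, s, rfl, by have := sizeOf_pos s; simp; omega, by simp⟩)
  | opMul o u s =>
    exact .inr (.inr ⟨op o u, s, rfl, by have := sizeOf_pos s; simp; omega, by simp⟩)

/-- If the middle word has at least two letters, the two junctions do not interact. If it is a
differential letter, both products are concatenations. For a middle letter `P(v)` the outer words
reduce to single letters, and the only real case is `P(u)`, `P(v)`, `P(w)`. -/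
theorem dia_assoc (r s t : BWord Sym Z) :
    diaL lam (dia lam r s) (word k t) = diaL lam (word k r) (dia lam s t) := by
  rcases word_cases s with hs | ⟨v, rfl⟩ | ⟨a, s', rfl, _, _⟩
  · rw [hs.dia_right, diaL_mul_left, hs.diaL_left, ← diaL_word, hs.diaL_left, diaL_mul_right,
      hs.diaL_right, mul_assoc]
  · rcases word_cases r with hr | ⟨u, rfl⟩ | ⟨a, r', rfl, _, _⟩
    · rw [← diaL_word, hr.diaL_left, hr.diaL_left, diaL_mul_left, diaL_word]
    · rcases word_cases t with ht | ⟨w, rfl⟩ | ⟨a, t', rfl, _, _⟩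
      · rw [ht.diaL_right, ht.dia_right, diaL_mul_right, diaL_word]
      -- After expansion by the Rota-Baxter identity, both sides differ by smaller instances of
      -- associativity under `P`: one for each nonempty set of brackets removed from `P(u)`, `P(v)`,
      -- `P(w)`. Removing `j` brackets contributes the coefficient `lam ^ (j - 1)`.
      · have h1 := congrArg (opLin k Z P) (dia_assoc u (op P v) (op P w))
        have h2 := congrArg (opLin k Z P) (dia_assoc (op P u) v (op P w))
        have h3 := congrArg (opLin k Z P) (dia_assoc (op P u) (op P v) w)
        have h4 := congrArg (opLin k Z P) (dia_assoc u v (op P w))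
        have h5 := congrArg (opLin k Z P) (dia_assoc u (op P v) w)
        have h6 := congrArg (opLin k Z P) (dia_assoc (op P u) v w)
        have h7 := congrArg (opLin k Z P) (dia_assoc u v w)
        simp only [← diaL_word, ← opLin_word] at h1 h2 h3 h4 h5 h6 h7 ⊢
        generalize word k u = x at *
        generalize word k v = y at *
        generalize word k w = z at *
        rw [diaL_opLin lam x y, diaL_opLin lam y z]
        rw [diaL_opLin lam y z] at h1
        rw [diaL_opLin lam x y] at h3
        simp only [map_add, map_smul, LinearMap.add_apply, LinearMap.smul_apply, diaL_opLin,
          smul_add] at h1 h2 h3 h4 h5 h6 h7 ⊢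
        linear_combination (norm := module)
          h1 + h2 + h3 + lam • h4 + lam • h5 + lam • h6 + (lam * lam) • h7
      · rw [word_mul, diaL_mul_right, dia_mul_right, diaL_mul_right,
          dia_assoc (op P u) (op P v) a]
    · rw [dia_mul_left, diaL_mul_left, dia_assoc r' (op P v) t, word_mul, diaL_mul_left]
  · rw [dia_mul_left, diaL_mul_right, dia_mul_right, diaL_mul_left]
    simp only [diaL_word]
termination_by sizeOf r + sizeOf s + sizeOf t
decreasing_by all_goals simp_all; try omega

end Dia

/-! ### The differential operator of the model -/

section Der

variable {k : Type u} [CommRing k] {Z : Type v} (lam b : k)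

/-- The derivation of weight `lam` of the free operated algebra with `P(u) ↦ P(D(u)) + b P(u)`. -/
noncomputable def der : BWord Sym Z → Poly k Sym Z
  | var z => word k (op D (var z))
  | op D u => word k (op D (op D u))
  | op P u => opLin k Z P (der u) + b • word k (op P u)
  | varMul z t => word k (op D (var z)) * word k t + word k (var z) * der t
      + lam • (word k (op D (var z)) * der t)
  | opMul D u t => word k (op D (op D u)) * word k t + word k (op D u) * der t
      + lam • (word k (op D (op D u)) * der t)
  | opMul P u t => (opLin k Z P (der u) + b • word k (op P u)) * word k t
      + word k (op P u) * der t + lam • ((opLin k Z P (der u) + b • word k (op P u)) * der t)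

/-- The linear extension of `der`. -/
noncomputable def derL : Poly k Sym Z →ₗ[k] Poly k Sym Z := wordLift k (der lam b)

theorem IsDiffLetter.der {a : BWord Sym Z} (ha : IsDiffLetter a) :
    der lam b a = word k (op D a) := by
  match a, ha with
  | var _, _ => rfl
  | op D _, _ => rfl

theorem der_varMul (z : Z) (t : BWord Sym Z) :
    der lam b (varMul z t) = der lam b (var z) * word k t + word k (var z) * der lam b t
      + lam • (der lam b (var z) * der lam b t) := rfl

theorem der_opMul (o : Sym) (u t : BWord Sym Z) :
    der lam b (opMul o u t) = der lam b (op o u) * word k t + word k (op o u) * der lam b t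
      + lam • (der lam b (op o u) * der lam b t) := by
  cases o <;> rfl

theorem der_mul (s t : BWord Sym Z) :
    der lam b (s * t) = der lam b s * word k t + word k s * der lam b t
      + lam • (der lam b s * der lam b t) := by
  induction s with
  | var z => exact der_varMul lam b z t
  | op o u _ => exact der_opMul lam b o u t
  | varMul z s ih =>
    change der lam b (varMul z (s * t)) = _
    rw [der_varMul, der_varMul, ih, word_mul, word_varMul]
    simp only [mul_add, add_mul, smul_add, mul_assoc, smul_mul_assoc, mul_smul_comm]
    abel
  | opMul o u s _ ih =>
    change der lam b (opMul o u (s * t)) = _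
    rw [der_opMul, der_opMul, ih, word_mul, word_opMul]
    simp only [mul_add, add_mul, smul_add, mul_assoc, smul_mul_assoc, mul_smul_comm]
    abel

theorem derL_mul (x y : Poly k Sym Z) :
    derL lam b (x * y) = derL lam b x * y + x * derL lam b y
      + lam • (derL lam b x * derL lam b y) := by
  induction x using poly_induction with
  | zero => simp
  | add x x' h h' => simp only [add_mul, map_add, h, h', smul_add]; abel
  | smul c x h => simp only [smul_mul_assoc, map_smul, h, smul_add, smul_comm c lam]
  | word r =>
    induction y using poly_induction with
    | zero => simp
    | add x x' h h' => simp only [mul_add, map_add, h, h', smul_add]; abel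
    | smul c x h => simp only [mul_smul_comm, map_smul, h, smul_add, smul_comm c lam]
    | word s => simp [← word_mul, derL, der_mul]

theorem derL_opLin (x : Poly k Sym Z) :
    derL lam b (opLin k Z P x) = opLin k Z P (derL lam b x) + b • opLin k Z P x := by
  induction x using poly_induction with
  | zero => simp
  | add x x' h h' => simp only [map_add, h, h', smul_add]; abel
  | smul c x h => simp only [map_smul, h, smul_add, smul_comm c b]
  | word r => simp [derL, der]

variable {lam b}

/-- Since `derL` already satisfies the Leibniz rule for concatenation, only the junction `P(u)P(w)`
needs an argument. There the Rota-Baxter expansion reduces the claim to smaller pairs. -/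
theorem derL_dia (hb : lam * b = 0) (s t : BWord Sym Z) :
    derL lam b (dia lam s t) = diaL lam (der lam b s) (word k t) + diaL lam (word k s) (der lam b t)
      + lam • diaL lam (der lam b s) (der lam b t) := by
  have hD : ∀ a : BWord Sym Z, derL lam b (word k a) = der lam b a := fun a => by simp [derL]
  rcases word_cases s with hs | ⟨u, rfl⟩ | ⟨a, s', rfl, _, _⟩
  · have hs' : IsDiffLetter (op D s) := trivial
    rw [← diaL_word, hs.diaL_left, hs.diaL_left, derL_mul, hD, hD, hs.der, hs'.diaL_left,
      hs'.diaL_left]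
  · rcases word_cases t with ht | ⟨w, rfl⟩ | ⟨a, t', rfl, _, _⟩
    · have ht' : IsDiffLetter (op D t) := trivial
      rw [ht.dia_right, ht.diaL_right, derL_mul, hD, hD, ht.der, ht'.diaL_right,
        ht'.diaL_right]
    · have h1 := congrArg (opLin k Z P) (derL_dia hb u (op P w))
      have h2 := congrArg (opLin k Z P) (derL_dia hb (op P u) w)
      have h3 := congrArg (opLin k Z P) (derL_dia hb u w)
      simp only [← diaL_word, ← hD, ← opLin_word] at h1 h2 h3 ⊢
      generalize word k u = x at *
      generalize word k w = y at *
      -- The summand `b P` in `derL (P x)` makes the two sides agree only up to multiples of `lam *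
      -- b`.
      have hb' : ∀ z : Poly k Sym Z, lam • b • z = 0 := fun z => by rw [smul_smul, hb, zero_smul]
      have hb'' : ∀ z : Poly k Sym Z, b • lam • z = 0 := fun z => by rw [smul_comm, hb']
      simp only [map_add, map_smul, LinearMap.add_apply, LinearMap.smul_apply, diaL_opLin,
        smul_add, derL_opLin, hb', hb'', add_zero] at h1 h2 h3 ⊢
      linear_combination (norm := module) h1 + h2 + lam • h3
    · rw [word_mul, dia_mul_right, derL_mul, derL_dia hb (op P u) a, hD, der_mul]
      simp only [map_add, map_smul, diaL_mul_right, diaL_word, add_mul, smul_add, smul_mul_assoc]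
      abel
  · rw [word_mul, dia_mul_left, derL_mul, derL_dia hb s' t, hD, der_mul]
    simp only [map_add, map_smul, diaL_mul_left, diaL_word, mul_add, smul_add, LinearMap.add_apply,
      LinearMap.smul_apply, mul_smul_comm]
    abel
termination_by sizeOf s + sizeOf t
decreasing_by all_goals simp_all; try omega

/-- The free operated algebra with the product `diaL`. -/
def DiaAlg (_lam : k) (Z : Type v) : Type (max u v) := Poly k Sym Z

noncomputable instance : AddCommGroup (DiaAlg lam Z) :=
  inferInstanceAs (AddCommGroup (Poly k Sym Z))

noncomputable instance : Module k (DiaAlg lam Z) := inferInstanceAs (Module k (Poly k Sym Z))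

noncomputable instance : Mul (DiaAlg lam Z) := ⟨fun x y => diaL (k := k) (Z := Z) lam x y⟩

noncomputable instance : NonUnitalRing (DiaAlg lam Z) where
  left_distrib x y z := map_add (diaL (k := k) (Z := Z) lam x) y z
  right_distrib x y z := LinearMap.map_add₂ (diaL (k := k) (Z := Z) lam) x y z
  zero_mul x := LinearMap.map_zero₂ (diaL (k := k) (Z := Z) lam) x
  mul_zero x := map_zero (diaL (k := k) (Z := Z) lam x)
  mul_assoc := by
    suffices h : ∀ x y z : Poly k Sym Z,
        diaL lam (diaL lam x y) z = diaL lam x (diaL lam y z) from h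
    intro x y z
    induction x using poly_induction with
    | zero => simp
    | add x x' h h' => simp [h, h']
    | smul c x h => simp [h]
    | word r =>
      induction y using poly_induction with
      | zero => simp
      | add x x' h h' => simp [h, h']
      | smul c x h => simp [h]
      | word s =>
        induction z using poly_induction with
        | zero => simp
        | add x x' h h' => simp [h, h']
        | smul c x h => simp [h]
        | word t => rw [diaL_word, diaL_word, dia_assoc]

instance : IsScalarTower k (DiaAlg lam Z) (DiaAlg lam Z) where
  smul_assoc c x y := LinearMap.map_smul₂ (diaL (k := k) (Z := Z) lam) c x y

instance : SMulCommClass k (DiaAlg lam Z) (DiaAlg lam Z) where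
  smul_comm c x y := (map_smul (diaL (k := k) (Z := Z) lam x) c y).symm

theorem isParaDRB_diaAlg {T : PType} (hT : T.Admissible lam b) :
    IsParaDRB (R := DiaAlg lam Z) T lam b (derL (Z := Z) lam b) (opLin k Z P) where
  admissible := hT
  diff := by
    -- In each type at least one of the two parameters vanishes.
    have hb : lam * b = 0 := by
      cases T <;> simp only [PType.Admissible] at hT <;> simp [hT]
    suffices h : ∀ x y : Poly k Sym Z, derL lam b (diaL lam x y) =
        diaL lam (derL lam b x) y + diaL lam x (derL lam b y)
          + lam • diaL lam (derL lam b x) (derL lam b y) from h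
    intro x y
    induction x using poly_induction with
    | zero => simp
    | add x x' h h' => simp only [map_add, LinearMap.add_apply, h, h', smul_add]; abel
    | smul c x h =>
      simp only [map_smul, LinearMap.smul_apply, h, smul_add, smul_comm c lam]
    | word r =>
      induction y using poly_induction with
      | zero => simp
      | add x x' h h' => simp only [map_add, h, h', smul_add]; abel
      | smul c x h => simp only [map_smul, h, smul_add, smul_comm c lam]
      | word s => rw [diaL_word, derL_dia hb]; simp only [derL, wordLift_word]
  rotaBaxter := by
    intro x y
    exact (diaL_opLin lam x y).trans (by rw [add_comm (opLin k Z P _)]; rfl)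
  mixed := derL_opLin lam b

end Der

/-! ### The universal property of the quotient -/

section Universal

variable {k : Type u} [CommRing k] {Z : Type v} {lam b : k}

theorem subset_opIdeal {Ω : Type*} (S : Set (Poly k Ω Z)) : S ⊆ opIdeal S := fun x hx => by
  rw [opIdeal, SetLike.mem_coe, Submodule.mem_sInf]
  exact fun I hI => hI.2 hx

theorem eta_eq_of_sub_mem {Ω : Type*} {S : Set (Poly k Ω Z)} {x y : Poly k Ω Z} (h : x - y ∈ S) :
    eta S x = eta S y :=
  (eta_eq_iff S x y).2 (subset_opIdeal S h)

theorem isParaDRB_quot {T : PType} (hT : T.Admissible lam b) :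
    IsParaDRB T lam b (quotOp (relations lam b Z) D) (quotOp (relations lam b Z) P) where
  admissible := hT
  diff x y := by
    obtain ⟨x, rfl⟩ := eta_surjective _ x
    obtain ⟨y, rfl⟩ := eta_surjective _ y
    simp only [quotOp_eta, ← eta_mul, ← map_smul, ← map_add]
    refine eta_eq_of_sub_mem (Or.inr (Or.inl ⟨x, y, ?_⟩))
    rw [phi2]
    abel
  rotaBaxter x y := by
    obtain ⟨x, rfl⟩ := eta_surjective _ x
    obtain ⟨y, rfl⟩ := eta_surjective _ y
    simp only [quotOp_eta, ← eta_mul, ← map_smul, ← map_add]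
    refine eta_eq_of_sub_mem (Or.inl ⟨x, y, ?_⟩)
    simp only [phi1, map_smul, map_add]
    abel
  mixed x := by
    obtain ⟨x, rfl⟩ := eta_surjective _ x
    simp only [quotOp_eta, ← map_smul, ← map_add]
    refine eta_eq_of_sub_mem (Or.inr (Or.inr ⟨x, ?_⟩))
    rw [phi3]
    simp only [map_add, map_smul]
    abel

variable {R : Type w} [NonUnitalRing R] [Module k R]

/-- The value of a bracketed word in an algebra with two operators. -/
def evalWord (d p : R →ₗ[k] R) (f : Z → R) : BWord Sym Z → R
  | var z => f z
  | op D u => d (evalWord d p f u)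
  | op P u => p (evalWord d p f u)
  | varMul z t => f z * evalWord d p f t
  | opMul D u t => d (evalWord d p f u) * evalWord d p f t
  | opMul P u t => p (evalWord d p f u) * evalWord d p f t

theorem evalWord_mul (d p : R →ₗ[k] R) (f : Z → R) (s t : BWord Sym Z) :
    evalWord d p f (s * t) = evalWord d p f s * evalWord d p f t := by
  induction s with
  | var z => rfl
  | op o u _ => cases o <;> rfl
  | varMul z s ih =>
    change f z * evalWord d p f (s * t) = f z * evalWord d p f s * _
    rw [ih, mul_assoc]
  | opMul o u s _ ih =>
    cases o
    · change d _ * evalWord d p f (s * t) = d _ * evalWord d p f s * _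
      rw [ih, mul_assoc]
    · change p _ * evalWord d p f (s * t) = p _ * evalWord d p f s * _
      rw [ih, mul_assoc]

variable [IsScalarTower k R R] [SMulCommClass k R R]

/-- The homomorphism of operated algebras from the free operated algebra that extends `f`. -/
noncomputable def evalHom (d p : R →ₗ[k] R) (f : Z → R) : Poly k Sym Z →ₙₐ[k] R :=
  MonoidAlgebra.liftMagma k ⟨evalWord d p f, evalWord_mul d p f⟩

variable {d p : R →ₗ[k] R} {f : Z → R}

theorem evalHom_word (t : BWord Sym Z) : evalHom d p f (word k t) = evalWord d p f t := by
  simp [evalHom, word]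

theorem evalHom_opLin_D (x : Poly k Sym Z) :
    evalHom d p f (opLin k Z D x) = d (evalHom d p f x) := by
  induction x using poly_induction with
  | zero => simp
  | add x x' h h' => simp only [map_add, h, h']
  | smul c x h => simp only [map_smul, h]
  | word r => rw [opLin_word, evalHom_word, evalHom_word, evalWord]

theorem evalHom_opLin_P (x : Poly k Sym Z) :
    evalHom d p f (opLin k Z P x) = p (evalHom d p f x) := by
  induction x using poly_induction with
  | zero => simp
  | add x x' h h' => simp only [map_add, h, h']
  | smul c x h => simp only [map_smul, h]
  | word r => rw [opLin_word, evalHom_word, evalHom_word, evalWord]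

/-- The kernel of the evaluation is an operated ideal containing the relations, hence contains the
smallest such ideal. -/
theorem evalHom_eq_zero {T : PType} (h : IsParaDRB T lam b d p) {x : Poly k Sym Z}
    (hx : x ∈ opIdeal (relations lam b Z)) : evalHom d p f x = 0 := by
  rw [opIdeal, Submodule.mem_sInf] at hx
  refine LinearMap.mem_ker.1
    (hx (LinearMap.ker (evalHom d p f : Poly k Sym Z →ₗ[k] R)) ⟨⟨?_, ?_, ?_⟩, ?_⟩)
  · intro a y hy
    have hy' : evalHom d p f y = 0 := hy
    change evalHom d p f (a * y) = 0
    rw [map_mul, hy', mul_zero]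
  · intro a y hy
    have hy' : evalHom d p f y = 0 := hy
    change evalHom d p f (y * a) = 0
    rw [map_mul, hy', zero_mul]
  · intro o y hy
    have hy' : evalHom d p f y = 0 := hy
    change evalHom d p f (opLin k Z o y) = 0
    cases o
    · rw [evalHom_opLin_D, hy', map_zero]
    · rw [evalHom_opLin_P, hy', map_zero]
  · rintro y (⟨s, t, rfl⟩ | ⟨s, t, rfl⟩ | ⟨s, rfl⟩)
    · change evalHom d p f _ = 0
      simp only [phi1, map_sub, map_smul, map_mul, evalHom_opLin_P, h.rotaBaxter]
      abel
    · change evalHom d p f _ = 0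
      simp only [phi2, map_sub, map_smul, map_mul, evalHom_opLin_D, h.diff]
      abel
    · change evalHom d p f _ = 0
      simp only [phi3, map_sub, map_smul, evalHom_opLin_D, evalHom_opLin_P, h.mixed]
      abel

/-- The homomorphism from the quotient that extends `f`. -/
noncomputable def quotLift {T : PType} (h : IsParaDRB T lam b d p) (f : Z → R) :
    QuotAlg (relations lam b Z) →ₙₐ[k] R :=
  { (opIdeal (relations lam b Z)).liftQ (evalHom d p f : Poly k Sym Z →ₗ[k] R)
      (fun _ hx => evalHom_eq_zero h hx) with
    map_zero' := map_zero _
    map_mul' := fun x y => by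
      obtain ⟨x, rfl⟩ := eta_surjective _ x
      obtain ⟨y, rfl⟩ := eta_surjective _ y
      exact map_mul (evalHom d p f) x y }

theorem quotLift_eta {T : PType} (h : IsParaDRB T lam b d p) (x : Poly k Sym Z) :
    quotLift h f (eta _ x) = evalHom d p f x := rfl

theorem existsUnique_quotLift {T : PType} (h : IsParaDRB T lam b d p) (f : Z → R) :
    ∃! F : QuotAlg (relations lam b Z) →ₙₐ[k] R,
      (∀ x, F (quotOp (relations lam b Z) D x) = d (F x)) ∧
      (∀ x, F (quotOp (relations lam b Z) P x) = p (F x)) ∧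
      (∀ z, F (eta (relations lam b Z) (word k (var z))) = f z) := by
  refine ⟨quotLift h f, ⟨fun x => ?_, fun x => ?_, fun z => ?_⟩, ?_⟩
  · obtain ⟨x, rfl⟩ := eta_surjective _ x
    rw [quotOp_eta, quotLift_eta, quotLift_eta, evalHom_opLin_D]
  · obtain ⟨x, rfl⟩ := eta_surjective _ x
    rw [quotOp_eta, quotLift_eta, quotLift_eta, evalHom_opLin_P]
  · rw [quotLift_eta, evalHom_word, evalWord]
  · rintro F ⟨hd, hp, hf⟩
    have hop : ∀ o u, F (eta _ (word k u)) = evalWord d p f u →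
        F (eta _ (word k (op o u))) = evalWord d p f (op o u) := by
      intro o u ih
      rw [← opLin_word, ← quotOp_eta]
      cases o
      · rw [hd, ih, evalWord]
      · rw [hp, ih, evalWord]
    have hw : ∀ t, F (eta _ (word k t)) = evalWord d p f t := by
      intro t
      induction t with
      | var z => rw [hf, evalWord]
      | op o u ih => exact hop o u ih
      | varMul z t ih => rw [word_varMul, eta_mul, map_mul, ih, hf, evalWord]
      | opMul o u t ihu iht =>
        rw [word_opMul, eta_mul, map_mul, iht, hop o u ihu]
        exact (evalWord_mul d p f (op o u) t).symm
    ext x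
    obtain ⟨x, rfl⟩ := eta_surjective _ x
    rw [quotLift_eta]
    induction x using poly_induction with
    | zero => simp
    | add x x' h h' => simp only [map_add, h, h']
    | smul c x h => simp only [map_smul, h]
    | word r => rw [hw, evalHom_word]

end Universal

/-! ### Irreducible words -/

section Irreducible

variable {Ω : Type u} {Z : Type v}

/-- The words `D^n(z)`. -/
def IsDeltaWord : BWord Sym Z → Prop
  | var _ => True
  | op D u => IsDeltaWord u
  | _ => False

/-- The words whose first letter is of the form `P(u)`. -/
def StartsWithP : BWord Sym Z → Prop
  | op P _ => True
  | opMul P _ _ => True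
  | _ => False

/-- A recursive description of the irreducible words. -/
def IsNormal : BWord Sym Z → Prop
  | var _ => True
  | op D u => IsDeltaWord u
  | op P u => IsNormal u
  | varMul _ t => IsNormal t
  | opMul D u t => IsDeltaWord u ∧ IsNormal t
  | opMul P u t => IsNormal u ∧ IsNormal t ∧ ¬ StartsWithP t

theorem IsDeltaWord.isNormal {t : BWord Sym Z} (h : IsDeltaWord t) : IsNormal t := by
  match t, h with
  | var _, _ => trivial
  | op D _, h => exact h

theorem IsDeltaWord.isDiffLetter {t : BWord Sym Z} (h : IsDeltaWord t) : IsDiffLetter t := by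
  match t, h with
  | var _, _ => trivial
  | op D _, h => trivial

theorem not_isDeltaWord_mul (s t : BWord Sym Z) : ¬ IsDeltaWord (s * t) := by
  cases s <;> exact id

theorem isNormal_of_op {o : Sym} {u : BWord Sym Z} (h : IsNormal (op o u)) : IsNormal u := by
  cases o
  · exact IsDeltaWord.isNormal h
  · exact h

theorem startsWithP_mul (s t : BWord Sym Z) : StartsWithP (s * t) ↔ StartsWithP s := by
  rcases s with z | ⟨o, u⟩ | ⟨z, s⟩ | ⟨o, u, s⟩
  · exact Iff.rfl
  · cases o <;> exact Iff.rfl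
  · exact Iff.rfl
  · cases o <;> exact Iff.rfl

theorem isNormal_of_mul {s t : BWord Sym Z} (h : IsNormal (s * t)) : IsNormal s ∧ IsNormal t := by
  induction s with
  | var z => exact ⟨trivial, h⟩
  | op o u _ =>
    cases o
    · exact h
    · exact ⟨h.1, h.2.1⟩
  | varMul z s ih => exact ih h
  | opMul o u s _ ih =>
    cases o
    · exact ⟨⟨h.1, (ih h.2).1⟩, (ih h.2).2⟩
    · exact ⟨⟨h.1, (ih h.2.1).1, fun hs => h.2.2 ((startsWithP_mul s t).2 hs)⟩, (ih h.2.1).2⟩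

theorem IsDeltaWord.isNormal_mul {a t : BWord Sym Z} (ha : IsDeltaWord a) (ht : IsNormal t) :
    IsNormal (a * t) ∧ ¬ StartsWithP (a * t) := by
  match a, ha with
  | var _, _ => exact ⟨ht, id⟩
  | op D _, h => exact ⟨⟨h, ht⟩, id⟩

theorem starCount_mul (q r : BWord Ω (Option Z)) :
    starCount (q * r) = starCount q + starCount r := by
  induction q with
  | var z => cases z <;> simp [mul_def, BWord.mul, starCount]
  | op o u _ => rfl
  | varMul z q ih =>
    change starCount (varMul z (q * r)) = _
    cases z <;> simp [starCount, ih, add_assoc]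
  | opMul o u q _ ih =>
    change starCount (opMul o u (q * r)) = _
    simp [starCount, ih, add_assoc]

theorem plug_mul (q r : BWord Ω (Option Z)) (u : BWord Ω Z) :
    plug (q * r) u = plug q u * plug r u := by
  induction q with
  | var z => rfl
  | op o v _ => rfl
  | varMul z q ih =>
    change _ * plug (q * r) u = _ * plug q u * _
    rw [ih, mul_assoc]
  | opMul o v q _ ih =>
    change _ * plug (q * r) u = _ * plug q u * _
    rw [ih, mul_assoc]

/-- A word viewed as a word over `Z ∪ {⋆}`. -/
def embed : BWord Ω Z → BWord Ω (Option Z) := subst fun z => var (some z)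

theorem starCount_embed (t : BWord Ω Z) : starCount (embed t) = 0 := by
  induction t with
  | var z => rfl
  | op o u ih => exact ih
  | varMul z t ih => exact (starCount_mul _ _).trans (by rw [← embed, ih]; rfl)
  | opMul o u t ihu iht =>
    exact (starCount_mul _ _).trans (by rw [← embed, iht]; exact ihu)

theorem plug_embed (t u : BWord Ω Z) : plug (embed t) u = t := by
  induction t with
  | var z => rfl
  | op o v ih => exact congrArg (op o) ih
  | varMul z t ih => exact (plug_mul _ _ _).trans (by rw [← embed, ih]; rfl)
  | opMul o v t ihv iht =>
    refine (plug_mul _ _ _).trans ?_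
    rw [← embed, iht]
    change op o (plug (embed v) u) * t = _
    rw [ihv]
    rfl

/-- The leading words of the defining relations. -/
def IsLeading (t : BWord Sym Z) : Prop :=
  (∃ u v, t = op P u * op P v) ∨ (∃ u v, t = op D (u * v)) ∨ ∃ u, t = op D (op P u)

theorem mem_irr_iff {t : BWord Sym Z} :
    t ∈ irr Z ↔ ∀ (q : BWord Sym (Option Z)) (s : BWord Sym Z), q.IsStarWord → IsLeading s →
      t ≠ q.plug s := by
  simp only [irr, IsLeading, Set.mem_sdiff, Set.mem_univ, true_and, Set.mem_ofPred_eq]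
  constructor
  · rintro h q s hq (⟨u, w, rfl⟩ | ⟨u, w, rfl⟩ | ⟨u, rfl⟩) rfl
    · exact h ⟨q, hq, .inl ⟨u, w, rfl⟩⟩
    · exact h ⟨q, hq, .inr (.inl ⟨u, w, rfl⟩)⟩
    · exact h ⟨q, hq, .inr (.inr ⟨u, rfl⟩)⟩
  · rintro h ⟨q, hq, ⟨u, w, e⟩ | ⟨u, w, e⟩ | ⟨u, e⟩⟩
    · exact h q _ hq (.inl ⟨u, w, rfl⟩) e
    · exact h q _ hq (.inr (.inl ⟨u, w, rfl⟩)) e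
    · exact h q _ hq (.inr (.inr ⟨u, rfl⟩)) e

theorem IsLeading.not_isNormal {t : BWord Sym Z} (h : IsLeading t) : ¬ IsNormal t := by
  rcases h with ⟨u, v, rfl⟩ | ⟨u, v, rfl⟩ | ⟨u, rfl⟩
  · exact fun h => h.2.2 trivial
  · exact not_isDeltaWord_mul u v
  · exact id

/-- Normality passes to subwords. Asking only that `⋆` occur, rather than exactly once, lets the
induction descend into whichever factor contains it. -/
theorem isNormal_of_plug {q : BWord Sym (Option Z)} {u : BWord Sym Z} (hq : starCount q ≠ 0)
    (h : IsNormal (plug q u)) : IsNormal u := by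
  induction q with
  | var z =>
    cases z with
    | none => exact h
    | some z => exact absurd rfl hq
  | op o v ih => exact ih hq (isNormal_of_op h)
  | varMul z q ih =>
    cases z with
    | none => exact (isNormal_of_mul h).1
    | some z => exact ih hq (isNormal_of_mul h).2
  | opMul o v q ihv ihq =>
    by_cases hv : starCount v = 0
    · exact ihq (fun hz => hq (by simp [starCount, hv, hz])) (isNormal_of_mul h).2
    · exact ihv hv (isNormal_of_op (isNormal_of_mul h).1)

theorem IsLeading.not_mem_irr {t : BWord Sym Z} (h : IsLeading t) : t ∉ irr Z :=
  fun ht => mem_irr_iff.1 ht (var none) t rfl h rfl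

theorem mem_irr_of_op {o : Sym} {t : BWord Sym Z} (h : op o t ∈ irr Z) : t ∈ irr Z :=
  mem_irr_iff.2 fun q s hq hs e => mem_irr_iff.1 h (op o q) s hq hs (congrArg (op o) e)

/-- A forbidden subword of a factor is one of the product: the context is enlarged by the other
factor, embedded as a word without `⋆`. -/
theorem mem_irr_of_mul {s t : BWord Sym Z} (h : s * t ∈ irr Z) : s ∈ irr Z ∧ t ∈ irr Z := by
  refine ⟨mem_irr_iff.2 fun q r hq hr e => mem_irr_iff.1 h (q * embed t) r ?_ hr ?_,
    mem_irr_iff.2 fun q r hq hr e => mem_irr_iff.1 h (embed s * q) r ?_ hr ?_⟩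
  · rw [IsStarWord, starCount_mul, starCount_embed, hq]
  · rw [plug_mul, plug_embed, e]
  · rw [IsStarWord, starCount_mul, starCount_embed, hq]
  · rw [plug_mul, plug_embed, e]

theorem isNormal_op_of_mem_irr {o : Sym} {u : BWord Sym Z} (hu : IsNormal u)
    (h : op o u ∈ irr Z) : IsNormal (op o u) := by
  cases o with
  | P => exact hu
  | D =>
    rcases word_cases u with hd | ⟨v, rfl⟩ | ⟨a, s, rfl, _, _⟩
    · match u, hd, hu with
      | var z, _, _ => trivial
      | op D v, _, hu => exact hu
    · exact absurd h (IsLeading.not_mem_irr (.inr (.inr ⟨v, rfl⟩)))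
    · exact absurd h (IsLeading.not_mem_irr (.inr (.inl ⟨a, s, rfl⟩)))

theorem mem_irr_iff_isNormal {t : BWord Sym Z} : t ∈ irr Z ↔ IsNormal t := by
  constructor
  · intro h
    induction t with
    | var z => trivial
    | op o u ih => exact isNormal_op_of_mem_irr (ih (mem_irr_of_op h)) h
    | varMul z t ih => exact ih (mem_irr_of_mul (s := var z) h).2
    | opMul o u t ihu iht =>
      obtain ⟨h1, h2⟩ := mem_irr_of_mul (s := op o u) h
      have h3 := isNormal_op_of_mem_irr (ihu (mem_irr_of_op h1)) h1
      cases o with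
      | D => exact ⟨h3, iht h2⟩
      | P =>
        refine ⟨h3, iht h2, fun ht => ?_⟩
        match t, ht with
        | op P w, _ => exact IsLeading.not_mem_irr (.inl ⟨u, w, rfl⟩) h
        | opMul P w t, _ =>
          exact IsLeading.not_mem_irr (.inl ⟨u, w, rfl⟩)
            (mem_irr_of_mul (s := op P u * op P w) (t := t) h).1
  · intro h
    refine mem_irr_iff.2 fun q s hq hs e => hs.not_isNormal (isNormal_of_plug (q := q) ?_ (e ▸ h))
    rw [hq]
    exact one_ne_zero

end Irreducible

/-! ### Differential Rota-Baxter bracketed words -/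

section FrakX

open scoped Pointwise

variable {Z : Type v}

theorem mem_delta_iff {t : BWord Sym Z} : t ∈ delta Z ↔ IsDeltaWord t := by
  constructor
  · rintro ⟨z, n, rfl⟩
    induction n with
    | zero => trivial
    | succ n ih =>
      rw [Function.iterate_succ_apply']
      exact ih
  · intro h
    induction t with
    | var z => exact ⟨z, 0, rfl⟩
    | op o u ih =>
      cases o with
      | D =>
        obtain ⟨z, n, rfl⟩ := ih h
        exact ⟨z, n + 1, (Function.iterate_succ_apply' _ _ _).symm⟩
      | P => exact h.elim
    | varMul z t _ => exact h.elim
    | opMul o u t _ _ => exact h.elim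

theorem powMul_subset {A B S : Set (BWord Sym Z)} (hA : A * S ⊆ S) (hB : B ⊆ S) (r : ℕ) :
    powMul A r B ⊆ S := by
  induction r with
  | zero => exact hB
  | succ r ih =>
    rw [powMul, Function.iterate_succ_apply']
    exact (Set.mul_subset_mul_left ih).trans hA

/-- The shift `A (BA)^r = (AB)^r A`, which shows that a prepended factor yields an alternating
product again. -/
theorem mul_powMul (A B C : Set (BWord Sym Z)) (r : ℕ) :
    A * powMul (B * A) r C = powMul (A * B) r (A * C) := by
  induction r with
  | zero => rfl
  | succ r ih =>
    simp only [powMul, Function.iterate_succ_apply'] at ih ⊢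
    rw [← ih]
    simp only [mul_assoc]

/-- The alternating products that begin with a factor in `Y`. -/
def altLeft (Y W : Set (BWord Sym Z)) : Set (BWord Sym Z) :=
  (⋃ r : ℕ, powMul (Y * W) r (Y * W)) ∪ ⋃ r : ℕ, powMul (Y * W) r Y

/-- The four families form two pairs exchanged by swapping the two factors, so one argument about
`altLeft` can serve both. -/
theorem altProd_eq (Y W : Set (BWord Sym Z)) :
    altProd Y W = altLeft Y (op P '' W) ∪ altLeft (op P '' W) Y := by
  rw [altProd, altLeft, altLeft, ← Set.union_assoc]

theorem subset_altLeft (Y W : Set (BWord Sym Z)) : Y ⊆ altLeft Y W :=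
  fun _ hx => .inr (Set.mem_iUnion.2 ⟨0, hx⟩)

theorem mul_altLeft_subset (Y W : Set (BWord Sym Z)) : Y * altLeft W Y ⊆ altLeft Y W := by
  rw [altLeft, Set.mul_union, Set.mul_iUnion, Set.mul_iUnion]
  refine Set.union_subset (Set.iUnion_subset fun r => ?_) (Set.iUnion_subset fun r => ?_)
  · rw [mul_powMul, ← mul_assoc]
    exact fun _ hx => .inr (Set.mem_iUnion.2 ⟨r + 1, hx⟩)
  · rw [mul_powMul]
    exact fun _ hx => .inl (Set.mem_iUnion.2 ⟨r, hx⟩)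

theorem mul_altLeft_subset_self {Y : Set (BWord Sym Z)} (W : Set (BWord Sym Z)) (hY : Y * Y ⊆ Y) :
    Y * altLeft Y W ⊆ altLeft Y W := by
  have key : ∀ (r : ℕ) {C : Set (BWord Sym Z)}, Y * C ⊆ C →
      Y * powMul (Y * W) r C ⊆ powMul (Y * W) r C := by
    intro r C hC
    cases r with
    | zero => exact hC
    | succ r =>
      rw [powMul, Function.iterate_succ_apply', ← mul_assoc, ← mul_assoc]
      exact Set.mul_subset_mul_right (Set.mul_subset_mul_right hY)
  rw [altLeft, Set.mul_union, Set.mul_iUnion, Set.mul_iUnion]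
  refine Set.union_subset_union (Set.iUnion_mono fun r => key r ?_)
    (Set.iUnion_mono fun r => key r hY)
  rw [← mul_assoc]
  exact Set.mul_subset_mul_right hY

/-- An alternating product is built from the right, passing between `S'` and `S` as factors from `W`
and `Y` are prepended in turn. -/
theorem altLeft_subset {Y W S S' : Set (BWord Sym Z)} (hY : Y ⊆ S) (hYS : Y * S' ⊆ S)
    (hWS : W * S ⊆ S') (hW : W ⊆ S') : altLeft Y W ⊆ S := by
  have h : Y * W * S ⊆ S := by
    rw [mul_assoc]
    exact (Set.mul_subset_mul_left hWS).trans hYS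
  exact Set.union_subset
    (Set.iUnion_subset fun r => powMul_subset h ((Set.mul_subset_mul_left hW).trans hYS) r)
    (Set.iUnion_subset fun r => powMul_subset h hY r)

/-- The clause about every normal `t` makes the induction work, since `(x * y) * t = x * (y * t)`.
-/
theorem isNormal_of_mem_closure {s : BWord Sym Z} (hs : s ∈ Subsemigroup.closure (delta Z)) :
    (IsNormal s ∧ ¬ StartsWithP s) ∧
      ∀ t, IsNormal t → IsNormal (s * t) ∧ ¬ StartsWithP (s * t) := by
  induction hs using Subsemigroup.closure_induction with
  | mem x hx =>
    have hx' := mem_delta_iff.1 hx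
    refine ⟨⟨hx'.isNormal, ?_⟩, fun t ht => hx'.isNormal_mul ht⟩
    match x, hx' with
    | var _, _ => exact id
    | op D _, _ => exact id
  | mul x y _ _ hx hy =>
    refine ⟨hx.2 y hy.1.1, fun t ht => ?_⟩
    rw [mul_assoc]
    exact hx.2 _ (hy.2 t ht).1

theorem isNormal_of_mem_frakX {n : ℕ} {t : BWord Sym Z} (ht : t ∈ frakX Z n) : IsNormal t := by
  induction n generalizing t with
  | zero => exact (isNormal_of_mem_closure ht).1.1
  | succ n ih =>
    rw [frakX, altProd_eq] at ht
    have h1 : (Subsemigroup.closure (delta Z) : Set (BWord Sym Z)) ⊆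
        {s | IsNormal s ∧ ¬ StartsWithP s} := fun s hs => (isNormal_of_mem_closure hs).1
    have h2 : (Subsemigroup.closure (delta Z) : Set (BWord Sym Z)) * {s | IsNormal s} ⊆
        {s | IsNormal s ∧ ¬ StartsWithP s} := by
      rintro _ ⟨s, hs, t, ht, rfl⟩
      exact (isNormal_of_mem_closure hs).2 t ht
    have h3 : (op P '' frakX Z n) * {s | IsNormal s ∧ ¬ StartsWithP s} ⊆ {s | IsNormal s} := by
      rintro _ ⟨_, ⟨s, hs, rfl⟩, t, ht, rfl⟩
      exact ⟨ih hs, ht.1, ht.2⟩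
    have h4 : (op P '' frakX Z n) ⊆ {s | IsNormal s} := by
      rintro _ ⟨s, hs, rfl⟩
      exact (ih hs : IsNormal s)
    rcases ht with ht | ht
    · exact (altLeft_subset h1 h2 h3 h4 ht).1
    · exact altLeft_subset h4 h3 h2 h1 ht

/-- The letters `P(u)` of one word may have different depths, yet all must be placed in the same
`frakX Z n`. Proving the claim for every `n` above a size bound achieves this without monotonicity
of `frakX`. -/
theorem mem_altLeft_of_isNormal {t : BWord Sym Z} (ht : IsNormal t) {n : ℕ}
    (hn : sizeOf t ≤ n + 1) :
    (StartsWithP t →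
      t ∈ altLeft (op P '' frakX Z n) (Subsemigroup.closure (delta Z) : Set (BWord Sym Z))) ∧
    (¬ StartsWithP t →
      t ∈ altLeft (Subsemigroup.closure (delta Z) : Set (BWord Sym Z)) (op P '' frakX Z n)) := by
  have hclos : ∀ {a : BWord Sym Z}, IsDeltaWord a →
      a ∈ (Subsemigroup.closure (delta Z) : Set (BWord Sym Z)) := fun ha =>
    Subsemigroup.subset_closure (mem_delta_iff.2 ha)
  have hmul : (Subsemigroup.closure (delta Z) : Set (BWord Sym Z)) *
      (Subsemigroup.closure (delta Z) : Set (BWord Sym Z)) ⊆ Subsemigroup.closure (delta Z) := by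
    rintro _ ⟨x, hx, y, hy, rfl⟩
    exact mul_mem hx hy
  have hleft : ∀ {a t : BWord Sym Z} {n : ℕ}, IsDeltaWord a →
      (StartsWithP t →
        t ∈ altLeft (op P '' frakX Z n) (Subsemigroup.closure (delta Z) : Set (BWord Sym Z))) ∧
      (¬ StartsWithP t →
        t ∈ altLeft (Subsemigroup.closure (delta Z) : Set (BWord Sym Z)) (op P '' frakX Z n)) →
      a * t ∈ altLeft (Subsemigroup.closure (delta Z) : Set (BWord Sym Z)) (op P '' frakX Z n) := by
    intro a t n ha h
    by_cases hP : StartsWithP t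
    · exact mul_altLeft_subset _ _ (Set.mul_mem_mul (hclos ha) (h.1 hP))
    · exact mul_altLeft_subset_self _ hmul (Set.mul_mem_mul (hclos ha) (h.2 hP))
  have hop : ∀ {u : BWord Sym Z} {n : ℕ}, sizeOf u ≤ n →
      (∀ {m : ℕ}, sizeOf u ≤ m + 1 →
        (StartsWithP u →
          u ∈ altLeft (op P '' frakX Z m) (Subsemigroup.closure (delta Z) : Set (BWord Sym Z))) ∧
        (¬ StartsWithP u →
          u ∈ altLeft (Subsemigroup.closure (delta Z) : Set (BWord Sym Z))
            (op P '' frakX Z m))) → op P u ∈ op P '' frakX Z n := by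
    intro u n hn h
    -- Sizes are positive, so `n = m + 1`. The bound then reads `sizeOf u ≤ m + 1`, exactly what
    -- places `u` in `altProd` over `frakX Z m`.
    obtain ⟨m, rfl⟩ := Nat.exists_eq_add_of_lt ((sizeOf_pos u).trans_le hn)
    rw [zero_add] at hn ⊢
    refine Set.mem_image_of_mem _ ?_
    rw [frakX, altProd_eq]
    by_cases hP : StartsWithP u
    · exact .inr ((h hn).1 hP)
    · exact .inl ((h hn).2 hP)
  induction t generalizing n with
  | var z => exact ⟨fun h => h.elim, fun _ => subset_altLeft _ _ (hclos trivial)⟩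
  | op o u ih =>
    cases o with
    | D => exact ⟨fun h => h.elim, fun _ => subset_altLeft _ _ (hclos (a := op D u) ht)⟩
    | P =>
      refine ⟨fun _ => subset_altLeft _ _ (hop ?_ (ih ht)), fun h => (h trivial).elim⟩
      simp at hn
      omega
  | varMul z t ih =>
    refine ⟨fun h => h.elim, fun _ => hleft (a := var z) trivial (ih ht ?_)⟩
    simp at hn
    omega
  | opMul o u t ihu iht =>
    have hu : sizeOf u ≤ n := by simp at hn; omega
    have ht' : sizeOf t ≤ n + 1 := by simp at hn; omega
    cases o with
    | D => exact ⟨fun h => h.elim, fun _ => hleft (a := op D u) ht.1 (iht ht.2 ht')⟩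
    | P =>
      refine ⟨fun _ => ?_, fun h => (h trivial).elim⟩
      exact mul_altLeft_subset _ _
        (Set.mul_mem_mul (hop hu (ihu ht.1)) ((iht ht.2.1 ht').2 ht.2.2))

theorem irr_eq_frakXInf (Z : Type v) : irr Z = frakXInf Z := by
  ext t
  rw [mem_irr_iff_isNormal, frakXInf, Set.mem_iUnion]
  refine ⟨fun h => ⟨sizeOf t + 1, ?_⟩, fun ⟨n, hn⟩ => isNormal_of_mem_frakX hn⟩
  have := mem_altLeft_of_isNormal h (n := sizeOf t) (by omega)
  rw [frakX, altProd_eq]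
  by_cases hP : StartsWithP t
  · exact .inr (this.1 hP)
  · exact .inl (this.2 hP)

end FrakX

/-! ### The basis of irreducible words -/

section Basis

variable {k : Type u} [CommRing k] {Z : Type v} {lam b : k}

/-! ### Linear independence of the irreducible words -/

theorem dia_of_not_startsWithP (u : BWord Sym Z) {t : BWord Sym Z} (ht : ¬ StartsWithP t) :
    dia lam (op P u) t = word k (op P u) * word k t := by
  match t, ht with
  | var _, _ => rw [dia]
  | varMul _ _, _ => rw [dia]
  | op D _, _ => rw [dia]
  | opMul D _ _, _ => rw [dia]
  | op P _, h => exact absurd trivial h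
  | opMul P _ _, h => exact absurd trivial h

/-- In a normal word `D` acts only on words `D^n(z)`, where `derL` just adds a bracket, and no
`P(u)` is followed by a letter `P(v)`, so `dia` merely concatenates. -/
theorem evalWord_diaAlg {t : BWord Sym Z} (ht : IsNormal t) :
    evalWord (R := DiaAlg lam Z) (derL (Z := Z) lam b) (opLin k Z P) (fun z => word k (var z)) t
      = word k t := by
  have hD : ∀ {u : BWord Sym Z}, IsDeltaWord u → derL lam b (word k u) = word k (op D u) :=
    fun hu => by rw [derL, wordLift_word, hu.isDiffLetter.der]
  induction t with
  | var z => rfl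
  | op o u ih =>
    cases o with
    | D => exact (congrArg (derL lam b) (ih (isNormal_of_op ht))).trans (hD ht)
    | P => exact (congrArg (opLin k Z P) (ih ht)).trans (opLin_word _ _)
  | varMul z t ih =>
    refine (congrArg (diaL lam (word k (var z))) (ih ht)).trans ?_
    rw [diaL_word, dia, word_varMul]
  | opMul o u t ihu iht =>
    cases o with
    | D =>
      refine (congrArg₂ (fun x y => diaL lam x y)
        ((congrArg (derL lam b) (ihu ht.1.isNormal)).trans (hD ht.1)) (iht ht.2)).trans ?_
      rw [diaL_word, dia, word_opMul]
    | P =>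
      refine (congrArg₂ (fun x y => diaL lam x y)
        ((congrArg (opLin k Z P) (ihu ht.1)).trans (opLin_word _ _)) (iht ht.2.1)).trans ?_
      rw [diaL_word, dia_of_not_startsWithP _ ht.2.2, word_opMul]

theorem linearIndependent_eta_word {T : PType} (hT : T.Admissible lam b) :
    LinearIndependent k fun t : irr Z => eta (relations lam b Z) (word k t.1) := by
  have h := isParaDRB_diaAlg (Z := Z) hT
  let G : QuotAlg (relations lam b Z) →ₙₐ[k] DiaAlg lam Z := quotLift h fun z => word k (var z)
  -- The same map as `G`, with its values read in `Poly k Sym Z`, where the words are a basis.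
  let F : QuotAlg (relations lam b Z) →ₗ[k] Poly k Sym Z :=
    { toFun := G
      map_add' := map_add G
      map_smul' := map_smul G }
  have hF : ∀ t : irr Z, F (eta (relations lam b Z) (word k t.1)) = word k t.1 := fun t =>
    (evalHom_word (R := DiaAlg lam Z) t.1).trans (evalWord_diaAlg (mem_irr_iff_isNormal.1 t.2))
  have hli : LinearIndependent k fun t : irr Z => word k t.1 := by
    refine LinearIndependent.of_comp (MonoidAlgebra.coeffLinearEquiv k).toLinearMap ?_
    have := (Finsupp.basisSingleOne (R := k) (ι := BWord Sym Z)).linearIndependent.comp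
      (Subtype.val : irr Z → _) Subtype.val_injective
    convert this using 1
    funext t
    simp [word]
  refine LinearIndependent.of_comp F ?_
  convert hli using 1
  exact funext hF

/-! ### Spanning by the irreducible words -/

/-- The span in the quotient of the normal words. -/
noncomputable def normalSpan (lam b : k) (Z : Type v) : Submodule k (QuotAlg (relations lam b Z)) :=
  Submodule.span k ((fun t => eta (relations lam b Z) (word k t)) '' {t | IsNormal t})

/-- The span in the quotient of the normal words whose first letter is not of the form `P(u)`. -/
noncomputable def normalSpanLeft (lam b : k) (Z : Type v) :
    Submodule k (QuotAlg (relations lam b Z)) :=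
  Submodule.span k
    ((fun t => eta (relations lam b Z) (word k t)) '' {t | IsNormal t ∧ ¬ StartsWithP t})

theorem eta_word_mem {t : BWord Sym Z} (ht : IsNormal t) :
    eta _ (word k t) ∈ normalSpan lam b Z :=
  Submodule.subset_span ⟨t, ht, rfl⟩

theorem eta_word_mem_left {t : BWord Sym Z} (ht : IsNormal t) (h : ¬ StartsWithP t) :
    eta _ (word k t) ∈ normalSpanLeft lam b Z :=
  Submodule.subset_span ⟨t, ⟨ht, h⟩, rfl⟩

theorem normalSpanLeft_le : normalSpanLeft lam b Z ≤ normalSpan lam b Z :=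
  Submodule.span_mono (Set.image_mono fun _ h => h.1)

variable {x y : QuotAlg (relations lam b Z)}

theorem IsDeltaWord.mul_mem {a : BWord Sym Z} (ha : IsDeltaWord a)
    (hx : x ∈ normalSpan lam b Z) : eta _ (word k a) * x ∈ normalSpanLeft lam b Z := by
  induction hx using Submodule.span_induction with
  | zero => simp
  | add x y _ _ hx hy => rw [mul_add]; exact add_mem hx hy
  | smul c x _ hx => rw [mul_smul_comm]; exact Submodule.smul_mem _ c hx
  | mem x hx =>
    obtain ⟨t, ht, rfl⟩ := hx
    rw [← eta_mul, ← word_mul]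
    exact eta_word_mem_left (ha.isNormal_mul ht).1 (ha.isNormal_mul ht).2

theorem quotOp_P_mem (hx : x ∈ normalSpan lam b Z) : quotOp _ P x ∈ normalSpan lam b Z := by
  induction hx using Submodule.span_induction with
  | zero => simp
  | add x y _ _ hx hy => rw [map_add]; exact add_mem hx hy
  | smul c x _ hx => rw [map_smul]; exact Submodule.smul_mem _ c hx
  | mem x hx =>
    obtain ⟨t, ht, rfl⟩ := hx
    rw [quotOp_eta, opLin_word]
    exact eta_word_mem (t := op P t) ht

theorem quotOp_P_mul_mem (hx : x ∈ normalSpan lam b Z) (hy : y ∈ normalSpanLeft lam b Z) :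
    quotOp _ P x * y ∈ normalSpan lam b Z := by
  induction hx using Submodule.span_induction with
  | zero => simp
  | add x y _ _ hx hy => rw [map_add, add_mul]; exact add_mem hx hy
  | smul c x _ hx => rw [map_smul, smul_mul_assoc]; exact Submodule.smul_mem _ c hx
  | mem x hx =>
    obtain ⟨s, hs, rfl⟩ := hx
    induction hy using Submodule.span_induction with
    | zero => simp
    | add x y _ _ hx hy => rw [mul_add]; exact add_mem hx hy
    | smul c x _ hx => rw [mul_smul_comm]; exact Submodule.smul_mem _ c hx
    | mem y hy =>
      obtain ⟨t, ht, rfl⟩ := hy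
      rw [quotOp_eta, opLin_word, ← eta_mul, ← word_mul]
      exact eta_word_mem (t := op P s * t) ⟨hs, ht.1, ht.2⟩

/-- Induction on total size. The second clause is needed when a letter `P(u)` is put in front: the
result is again normal only if the remaining product does not start with `P`. -/
theorem eta_word_mul_mem {T : PType} (hT : T.Admissible lam b) (s t : BWord Sym Z)
    (hs : IsNormal s) (ht : IsNormal t) :
    eta _ (word k s) * eta _ (word k t) ∈ normalSpan lam b Z ∧
      (¬ StartsWithP s → eta _ (word k s) * eta _ (word k t) ∈ normalSpanLeft lam b Z) := by
  match s, hs with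
  | var z, _ =>
    have h := IsDeltaWord.mul_mem (a := var z) trivial (eta_word_mem (lam := lam) (b := b) ht)
    exact ⟨normalSpanLeft_le h, fun _ => h⟩
  | op D u, hs =>
    have h := IsDeltaWord.mul_mem (a := op D u) hs (eta_word_mem (lam := lam) (b := b) ht)
    exact ⟨normalSpanLeft_le h, fun _ => h⟩
  | varMul z s, hs =>
    rw [word_varMul, eta_mul, mul_assoc]
    have h := IsDeltaWord.mul_mem (a := var z) trivial (eta_word_mul_mem hT s t hs ht).1
    exact ⟨normalSpanLeft_le h, fun _ => h⟩
  | opMul D u s, hs =>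
    rw [word_opMul, eta_mul, mul_assoc]
    have h := IsDeltaWord.mul_mem (a := op D u) hs.1 (eta_word_mul_mem hT s t hs.2 ht).1
    exact ⟨normalSpanLeft_le h, fun _ => h⟩
  | opMul P u s, hs =>
    refine ⟨?_, fun h => (h trivial).elim⟩
    rw [word_opMul, eta_mul, mul_assoc, ← opLin_word, ← quotOp_eta]
    exact quotOp_P_mul_mem (eta_word_mem hs.1) ((eta_word_mul_mem hT s t hs.2.1 ht).2 hs.2.2)
  | op P u, hs =>
    refine ⟨?_, fun h => (h trivial).elim⟩
    have hP : ∀ w, eta (relations lam b Z) (word k (op P w)) = quotOp _ P (eta _ (word k w)) :=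
      fun w => by rw [quotOp_eta, opLin_word]
    -- Membership of `P(u)P(w)` in the span would not suffice: when `P(w)` is followed by a word
    -- `t`, the form `P(x)` ensures that multiplying by `t` creates no new `P(v)P(v')`.
    have key : ∀ w : BWord Sym Z, IsNormal w → sizeOf w < sizeOf t →
        ∃ x ∈ normalSpan lam b Z,
          eta _ (word k (op P u)) * eta _ (word k (op P w)) = quotOp _ P x := by
      intro w hw hwt
      have h := add_mem (add_mem (eta_word_mul_mem hT (op P u) w hs hw).1
        (eta_word_mul_mem hT u (op P w) hs hw).1)
        (Submodule.smul_mem _ lam (eta_word_mul_mem hT u w hs hw).1)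
      refine ⟨_, h, ?_⟩
      rw [hP, hP, (isParaDRB_quot hT).rotaBaxter, ← map_smul, ← map_add, ← map_add]
    by_cases hP' : StartsWithP t
    · match t, ht, hP' with
      | op P w, ht, _ =>
        obtain ⟨x, hx, e⟩ := key w ht (by simp)
        rw [e]
        exact quotOp_P_mem hx
      | opMul P w t, ht, _ =>
        obtain ⟨x, hx, e⟩ := key w ht.1 (by simp; omega)
        rw [word_opMul, eta_mul, ← mul_assoc, e]
        exact quotOp_P_mul_mem hx (eta_word_mem_left ht.2.1 ht.2.2)
    · rw [hP]
      exact quotOp_P_mul_mem (eta_word_mem hs) (eta_word_mem_left ht hP')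
termination_by sizeOf s + sizeOf t
decreasing_by all_goals simp_all; try omega

/-- The Leibniz rule and `D(P(u)) = P(D(u) + b u)` push `D` inwards to the letters `D^n(z)`. As for
products, the second clause is what allows a letter `P(u)` in front. -/
theorem quotOp_D_mem {T : PType} (hT : T.Admissible lam b) (t : BWord Sym Z) (ht : IsNormal t) :
    quotOp _ D (eta _ (word k t)) ∈ normalSpan lam b Z ∧
      (¬ StartsWithP t → quotOp _ D (eta _ (word k t)) ∈ normalSpanLeft lam b Z) := by
  have hd : ∀ {a : BWord Sym Z}, IsDeltaWord a →
      quotOp _ D (eta _ (word k a)) ∈ normalSpanLeft lam b Z := by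
    intro a ha
    rw [quotOp_eta, opLin_word]
    exact eta_word_mem_left (t := op D a) ha id
  have hdm : ∀ {a s : BWord Sym Z}, IsDeltaWord a → IsNormal s →
      quotOp _ D (eta _ (word k s)) ∈ normalSpan lam b Z →
      quotOp _ D (eta _ (word k a * word k s)) ∈ normalSpanLeft lam b Z := by
    intro a s ha hs h
    have ha' : IsDeltaWord (op D a) := ha
    rw [eta_mul, (isParaDRB_quot hT).diff, quotOp_eta _ _ (word k a), opLin_word]
    exact add_mem (add_mem (ha'.mul_mem (eta_word_mem hs)) (ha.mul_mem h))
      (Submodule.smul_mem _ _ (ha'.mul_mem h))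
  have hp : ∀ {u : BWord Sym Z}, IsNormal u →
      quotOp _ D (eta _ (word k u)) ∈ normalSpan lam b Z →
      ∃ x ∈ normalSpan lam b Z, quotOp _ D (eta _ (word k (op P u))) = quotOp _ P x := by
    intro u hu h
    refine ⟨_, add_mem h (Submodule.smul_mem _ b (eta_word_mem hu)), ?_⟩
    rw [← opLin_word, ← quotOp_eta, (isParaDRB_quot hT).mixed, map_add, map_smul]
  induction t with
  | var z => exact ⟨normalSpanLeft_le (hd trivial), fun _ => hd trivial⟩
  | op o u ih =>
    cases o with
    | D =>
      have h : IsDeltaWord (op D u) := ht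
      exact ⟨normalSpanLeft_le (hd h), fun _ => hd h⟩
    | P =>
      refine ⟨?_, fun h => (h trivial).elim⟩
      obtain ⟨x, hx, e⟩ := hp (u := u) ht (ih ht).1
      rw [e]
      exact quotOp_P_mem hx
  | varMul z t ih =>
    rw [word_varMul]
    have h := hdm (a := var z) (s := t) trivial ht (ih ht).1
    exact ⟨normalSpanLeft_le h, fun _ => h⟩
  | opMul o u t ihu iht =>
    rw [word_opMul]
    cases o with
    | D =>
      have h := hdm (a := op D u) ht.1 ht.2 (iht ht.2).1
      exact ⟨normalSpanLeft_le h, fun _ => h⟩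
    | P =>
      refine ⟨?_, fun h => (h trivial).elim⟩
      obtain ⟨x, hx, e⟩ := hp ht.1 (ihu ht.1).1
      have h1 := eta_word_mem_left (lam := lam) (b := b) ht.2.1 ht.2.2
      have h2 := (iht ht.2.1).2 ht.2.2
      -- With `D(P(u)) = P(x)`, each of the three Leibniz terms is a value of `P` times an element
      -- of `normalSpanLeft`.
      rw [eta_mul, (isParaDRB_quot hT).diff, e, ← opLin_word, ← quotOp_eta]
      exact add_mem (add_mem (quotOp_P_mul_mem hx h1) (quotOp_P_mul_mem (eta_word_mem ht.1) h2))
        (Submodule.smul_mem _ _ (quotOp_P_mul_mem hx h2))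

theorem mul_mem_normalSpan {T : PType} (hT : T.Admissible lam b) (hx : x ∈ normalSpan lam b Z)
    (hy : y ∈ normalSpan lam b Z) : x * y ∈ normalSpan lam b Z := by
  induction hx using Submodule.span_induction with
  | zero => simp
  | add x y _ _ hx hy => rw [add_mul]; exact add_mem hx hy
  | smul c x _ hx => rw [smul_mul_assoc]; exact Submodule.smul_mem _ c hx
  | mem x hx =>
    obtain ⟨s, hs, rfl⟩ := hx
    induction hy using Submodule.span_induction with
    | zero => simp
    | add x y _ _ hx hy => rw [mul_add]; exact add_mem hx hy
    | smul c x _ hx => rw [mul_smul_comm]; exact Submodule.smul_mem _ c hx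
    | mem y hy =>
      obtain ⟨t, ht, rfl⟩ := hy
      exact (eta_word_mul_mem hT s t hs ht).1

theorem quotOp_mem_normalSpan {T : PType} (hT : T.Admissible lam b) (o : Sym)
    (hx : x ∈ normalSpan lam b Z) : quotOp _ o x ∈ normalSpan lam b Z := by
  cases o with
  | P => exact quotOp_P_mem hx
  | D =>
    induction hx using Submodule.span_induction with
    | zero => simp
    | add x y _ _ hx hy => rw [map_add]; exact add_mem hx hy
    | smul c x _ hx => rw [map_smul]; exact Submodule.smul_mem _ c hx
    | mem x hx =>
      obtain ⟨t, ht, rfl⟩ := hx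
      exact (quotOp_D_mem hT t ht).1

/-- The span contains the generators and is closed under products and both operators, so it contains
the image of every word. -/
theorem normalSpan_eq_top {T : PType} (hT : T.Admissible lam b) : normalSpan lam b Z = ⊤ := by
  have hw : ∀ t : BWord Sym Z, eta _ (word k t) ∈ normalSpan lam b Z := by
    have hop : ∀ (o : Sym) (u : BWord Sym Z), eta _ (word k u) ∈ normalSpan lam b Z →
        eta _ (word k (op o u)) ∈ normalSpan lam b Z := by
      intro o u h
      rw [← opLin_word, ← quotOp_eta]
      exact quotOp_mem_normalSpan hT o h
    intro t
    induction t with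
    | var z => exact eta_word_mem trivial
    | op o u ih => exact hop o u ih
    | varMul z t ih =>
      rw [word_varMul, eta_mul]
      exact mul_mem_normalSpan hT (eta_word_mem trivial) ih
    | opMul o u t ihu iht =>
      rw [word_opMul, eta_mul]
      exact mul_mem_normalSpan hT (hop o u ihu) iht
  refine Submodule.eq_top_iff'.2 fun x => ?_
  obtain ⟨x, rfl⟩ := eta_surjective _ x
  induction x using poly_induction with
  | zero => simp
  | add x y hx hy => rw [map_add]; exact add_mem hx hy
  | smul c x hx => rw [map_smul]; exact Submodule.smul_mem _ c hx
  | word t => exact hw t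

theorem exists_basis_irr {T : PType} (hT : T.Admissible lam b) :
    ∃ B : Module.Basis (irr Z) k (QuotAlg (relations lam b Z)),
      ∀ t : irr Z, B t = eta (relations lam b Z) (word k t.1) := by
  refine ⟨Module.Basis.mk (linearIndependent_eta_word hT) ?_, fun t => by
    rw [Module.Basis.mk_apply]⟩
  rw [← normalSpan_eq_top hT, normalSpan]
  refine Submodule.span_mono ?_
  rintro _ ⟨t, ht, rfl⟩
  exact ⟨⟨t, mem_irr_iff_isNormal.2 ht⟩, rfl⟩

end Basis

end ParaDRB

theorem mainTheorem4 {k : Type*} [CommRing k] (Z : Type*)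
    (T : ParaDRB.PType) (lam b : k) (hT : T.Admissible lam b) :
    -- the quotient is a para-differential Rota-Baxter algebra of type `T` ...
    (ParaDRB.IsParaDRB T lam b
        (ParaDRB.quotOp (ParaDRB.relations lam b Z) ParaDRB.Sym.D)
        (ParaDRB.quotOp (ParaDRB.relations lam b Z) ParaDRB.Sym.P)) ∧
    -- ... and it is the free one on `Z`
    (∀ (R : Type*) [NonUnitalRing R] [Module k R] [IsScalarTower k R R] [SMulCommClass k R R]
        (d P : R →ₗ[k] R), ParaDRB.IsParaDRB T lam b d P → ∀ f : Z → R,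
        ∃! F : ParaDRB.QuotAlg (ParaDRB.relations lam b Z) →ₙₐ[k] R,
          (∀ x, F (ParaDRB.quotOp (ParaDRB.relations lam b Z) ParaDRB.Sym.D x) = d (F x)) ∧
          (∀ x, F (ParaDRB.quotOp (ParaDRB.relations lam b Z) ParaDRB.Sym.P x) = P (F x)) ∧
          (∀ z, F (ParaDRB.eta (ParaDRB.relations lam b Z)
            (ParaDRB.word k (ParaDRB.BWord.var z))) = f z)) ∧
    -- the images of the irreducible words form a linear basis of it
    (∃ B : Module.Basis (ParaDRB.irr Z) k (ParaDRB.QuotAlg (ParaDRB.relations lam b Z)),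
        ∀ t : ParaDRB.irr Z,
          B t = ParaDRB.eta (ParaDRB.relations lam b Z) (ParaDRB.word k t.1)) ∧
    -- the irreducible words are the differential Rota-Baxter bracketed words
    ParaDRB.irr Z = ParaDRB.frakXInf Z := by
  exact ⟨ParaDRB.isParaDRB_quot hT, fun _ _ _ _ _ _ _ h f => ParaDRB.existsUnique_quotLift h f,
    ParaDRB.exists_basis_irr hT, ParaDRB.irr_eq_frakXInf Z⟩
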